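/- For $n\ge 1$ let $Q_n$ be the hypercube, i.e. the graph on the binary strings of length $n$ in which two strings are adjacent if and only if they differ in exactly one position, and let the folded hypercube $FQ_n$ be obtained from $Q_n$ by adding every edge that joins a string $u_1\cdots u_n$ to its complement $\bar u_1\cdots\bar u_n$, where $\bar u_i=1-u_i$. Let $K_{1,r}$ be the star with $r$ leaves. For graphs $G$ and $T$, a $T$-structure-cut (respectively, $T$-substructure-cut) of $G$ is a set $F$ of subgraphs of $G$, each isomorphic to $T$ (respectively, to a connected subgraph of $T$), such that the graph $G-F$, obtained from $G$ by deleting the vertices of all members of $F$, is disconnected, i.e. has at least two components. The members of $F$ need not be disjoint. The $T$-structure connectivity $\kappa(G;T)$ (respectively, $T$-substructure connectivity $\kappa^s(G;T)$) is the minimum cardinality of a $T$-structure-cut (respectively, $T$-substructure-cut) of $G$. For integers $r\ge 2$ define $$g(r)=\begin{cases}\max\left\{6,\ \dfrac{r+5}{2},\ \dfrac{r^2+4r-5}{8}\right\}, & r \text{ odd},\\[2ex] \max\left\{6,\ \dfrac{r^2+2r-8}{8},\ \dfrac{r+6}{2},\ \dfrac{r^2+6r}{12}\right\}, & r\text{ even}.\end{cases}$$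 **Theorem.** For all integers $r\ge 2$ and $n>g(r)$, $$\kappa(FQ_n;K_{1,r})=\kappa^s(FQ_n;K_{1,r})=\left\lceil\frac{n+1}{2}\right\rceil .$$ -/

import Mathlib

/-- The `n`-dimensional hypercube `Q_n`: binary strings of length `n`, two of them being adjacent
when they differ in exactly one position. -/
def hypercubeGraph (n : ℕ) : SimpleGraph (Fin n → Bool) where
  Adj u v := hammingDist u v = 1
  symm := ⟨fun u v h => by rw [hammingDist_comm]; exact h⟩
  loopless := ⟨fun u h => by simp at h⟩

/-- The folded hypercube `FQ_n`: the hypercube `Q_n` together with all the edges joining a string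
to its bitwise complement. -/
def foldedHypercube (n : ℕ) : SimpleGraph (Fin n → Bool) :=
  hypercubeGraph n ⊔ SimpleGraph.fromRel fun u v => v = fun i => !(u i)

/-- The star `K_{1,r}` with `r` leaves. -/
abbrev starK (r : ℕ) : SimpleGraph (Fin 1 ⊕ Fin r) :=
  completeBipartiteGraph (Fin 1) (Fin r)

section StructureConnectivity

variable {V W : Type*}

/-- `G - F`: the graph obtained from `G` by deleting the vertices of all members of `F`. -/
def deleteSubgraphs (G : SimpleGraph V) (F : Set G.Subgraph) :
    SimpleGraph ↥((⋃ H ∈ F, H.verts)ᶜ) :=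
  G.induce (⋃ H ∈ F, H.verts)ᶜ

/-- `F` is a `T`-structure-cut of `G`: each member of `F` is isomorphic to `T`, and `G - F` is
disconnected. (A graph is not preconnected exactly when it has at least two components; in
particular the graph without vertices does not count as disconnected.) -/
def IsStructureCut (G : SimpleGraph V) (T : SimpleGraph W) (F : Set G.Subgraph) : Prop :=
  (∀ H ∈ F, Nonempty (H.coe ≃g T)) ∧ ¬ (deleteSubgraphs G F).Preconnected

/-- `F` is a `T`-substructure-cut of `G`: each member of `F` is isomorphic to a connected subgraph
of `T`, and `G - F` is disconnected. -/
def IsSubstructureCut (G : SimpleGraph V) (T : SimpleGraph W) (F : Set G.Subgraph) : Prop :=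
  (∀ H ∈ F, ∃ T' : T.Subgraph, T'.Connected ∧ Nonempty (H.coe ≃g T'.coe)) ∧
    ¬ (deleteSubgraphs G F).Preconnected

/-- The `T`-structure connectivity `κ(G; T)`: the minimum cardinality of a `T`-structure-cut
(`⊤` if there is none). -/
noncomputable def structureConnectivity (G : SimpleGraph V) (T : SimpleGraph W) : ℕ∞ :=
  sInf {k : ℕ∞ | ∃ F : Set G.Subgraph, IsStructureCut G T F ∧ F.encard = k}

/-- The `T`-substructure connectivity `κˢ(G; T)`: the minimum cardinality of a
`T`-substructure-cut (`⊤` if there is none). -/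
noncomputable def substructureConnectivity (G : SimpleGraph V) (T : SimpleGraph W) : ℕ∞ :=
  sInf {k : ℕ∞ | ∃ F : Set G.Subgraph, IsSubstructureCut G T F ∧ F.encard = k}

end StructureConnectivity

/-- The threshold function `g(r)`, for `r ≥ 2`. -/
def starThreshold (r : ℕ) : ℚ :=
  if Odd r then
    max 6 (max (((r : ℚ) + 5) / 2) (((r : ℚ) ^ 2 + 4 * r - 5) / 8))
  else
    max 6 (max (((r : ℚ) ^ 2 + 2 * r - 8) / 8)
      (max (((r : ℚ) + 6) / 2) (((r : ℚ) ^ 2 + 6 * r) / 12)))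

/-! Upper bound: the n + 1 neighbours of a vertex u are taken in pairs. The two members of a pair
have a second common neighbour, and a star centred there contains both and avoids u. Hence n / 2 + 1
stars isolate u, and they also miss a vertex z far from u (`exists_structureCut`).

Lower bound: suppose at most n / 2 stars are deleted and A, B are complementary unions of components
of the rest. There are no triangles or pentagons, and two vertices have at most two common
neighbours; so a star contains at most two neighbours of a vertex outside it, and even at most two
neighbours of an edge outside it. As 2 (n / 2) < n + 1, A contains an edge. Its ends have 2 n + 2
distinct neighbours, of which at most n are deleted, so |A| ≥ n + 2, and likewise |B| ≥ n + 2
(`card_ge_of_neighbors_subset`). Already in Q_n, separating two such sets takes more than n (n - 1)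
/ 2 vertices (`HammingSeparated.card_add_lt`, by induction on slices), whereas the stars cover at
most (n / 2) (r + 1), which the threshold keeps below that (`half_mul_star_size_le`). -/

/-! ### Vertex isoperimetry in the hypercube, by slicing along one coordinate. -/

section Isoperimetry

/-- No vertex of `A` equals or is adjacent in the hypercube to a vertex of `B`. -/
def HammingSeparated {n : ℕ} (A B : Finset (Fin n → Bool)) : Prop :=
  ∀ u ∈ A, ∀ v ∈ B, 2 ≤ hammingDist u v

/-- The slice of `A` on which the first coordinate is `b`. -/
def cubeSlice {n : ℕ} (b : Bool) (A : Finset (Fin (n + 1) → Bool)) : Finset (Fin n → Bool) :=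
  Finset.univ.filter fun v => (Fin.cons b v : Fin (n + 1) → Bool) ∈ A

theorem mem_cubeSlice {n : ℕ} {b : Bool} {A : Finset (Fin (n + 1) → Bool)} {v : Fin n → Bool} :
    v ∈ cubeSlice b A ↔ (Fin.cons b v : Fin (n + 1) → Bool) ∈ A := by
  simp [cubeSlice]

theorem card_cubeSlice_add {n : ℕ} (A : Finset (Fin (n + 1) → Bool)) :
    (cubeSlice false A).card + (cubeSlice true A).card = A.card := by
  have h : ∀ b, (cubeSlice b A).card = (A.filter fun v => v 0 = b).card := by
    intro b
    refine Finset.card_bij (fun v _ => (Fin.cons b v : Fin (n + 1) → Bool)) ?_ ?_ ?_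
    · intro v hv
      simpa using mem_cubeSlice.1 hv
    · intro v _ w _ h
      exact Fin.cons_right_injective (α := fun _ => Bool) b h
    · intro w hw
      obtain ⟨hw, rfl⟩ := Finset.mem_filter.1 hw
      exact ⟨Fin.tail w, mem_cubeSlice.2 (by simpa using hw), by simp⟩
  rw [h, h, ← Finset.card_filter_add_card_filter_not (s := A) (fun v => v 0 = false)]
  simp

theorem hammingDist_cons {n : ℕ} (a b : Bool) (u v : Fin n → Bool) :
    hammingDist (Fin.cons a u : Fin (n + 1) → Bool) (Fin.cons b v) =
      (if a = b then 0 else 1) + hammingDist u v := by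
  simp only [hammingDist, Finset.card_filter, Fin.sum_univ_succ, Fin.cons_zero, Fin.cons_succ]
  congr 1
  split_ifs <;> simp_all

variable {n : ℕ}

theorem HammingSeparated.symm {A B : Finset (Fin n → Bool)} (h : HammingSeparated A B) :
    HammingSeparated B A := fun u hu v hv => by
  rw [hammingDist_comm]; exact h v hv u hu

theorem HammingSeparated.slice {A B : Finset (Fin (n + 1) → Bool)} (h : HammingSeparated A B)
    (b : Bool) : HammingSeparated (cubeSlice b A) (cubeSlice b B) := fun u hu v hv => by
  simpa [hammingDist_cons] using h _ (mem_cubeSlice.1 hu) _ (mem_cubeSlice.1 hv)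

/-- Points of opposite slices with the same projection are adjacent, so the projections are
disjoint. -/
theorem HammingSeparated.card_slice_add_le {A B : Finset (Fin (n + 1) → Bool)}
    (h : HammingSeparated A B) {b c : Bool} (hbc : b ≠ c) :
    (cubeSlice b A).card + (cubeSlice c B).card ≤ 2 ^ n := by
  have hd : Disjoint (cubeSlice b A) (cubeSlice c B) := by
    refine Finset.disjoint_left.2 fun v hv hv' => ?_
    simpa [hammingDist_cons, hbc] using h _ (mem_cubeSlice.1 hv) _ (mem_cubeSlice.1 hv')
  rw [← Finset.card_union_of_disjoint hd]
  refine (Finset.card_le_univ _).trans ?_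
  simp

theorem HammingSeparated.card_add_le {A B : Finset (Fin n → Bool)} (h : HammingSeparated A B) :
    A.card + B.card ≤ 2 ^ n := by
  have hd : Disjoint A B := Finset.disjoint_left.2 fun v hv hv' => by simpa using h v hv v hv'
  rw [← Finset.card_union_of_disjoint hd]
  refine (Finset.card_le_univ _).trans ?_
  simp

/-- The vertex boundary of a set of `a ≥ 1` vertices of the hypercube has at least
`a n - a (a + 1) / 2 + 1` elements. -/
theorem HammingSeparated.card_add_le_of_card : ∀ {n : ℕ} {A B : Finset (Fin n → Bool)},
    HammingSeparated A B → 1 ≤ A.card →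
    2 * (A.card + B.card : ℤ) + 2 * A.card * n - A.card * (A.card + 1) + 2 ≤ 2 * 2 ^ n
  | 0, A, B, h, hA => by
    have h1 := h.card_add_le
    have hA1 : A.card = 1 := by simp at h1; omega
    have hB : B.card = 0 := by simp at h1; omega
    simp [hA1, hB]
  | n + 1, A, B, h, hA => by
    have hAc := card_cubeSlice_add A
    have hBc := card_cubeSlice_add B
    have i0 := (h.slice false).card_add_le_of_card
    have i1 := (h.slice true).card_add_le_of_card
    have c0 := h.card_slice_add_le (b := false) (c := true) (by simp)
    have c1 := h.card_slice_add_le (b := true) (c := false) (by simp)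
    generalize (cubeSlice false A).card = a0 at *
    generalize (cubeSlice true A).card = a1 at *
    generalize (cubeSlice false B).card = b0 at *
    generalize (cubeSlice true B).card = b1 at *
    rw [← hAc, ← hBc, pow_succ]
    zify at c0 c1
    generalize (2 : ℤ) ^ n = N at *
    push_cast
    -- If A lies in one slice, its copy in the other slice avoids B and adds |A| to the boundary.
    rcases Nat.eq_zero_or_pos a0 with rfl | h0
    · have := i1 (by omega)
      push_cast at *
      nlinarith
    rcases Nat.eq_zero_or_pos a1 with rfl | h1
    · have := i0 (by omega)
      push_cast at *
      nlinarith
    have := i0 h0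
    have := i1 h1
    zify at h0 h1
    -- The slice bounds add up to the desired bound with surplus (a0 - 1) (a1 - 1).
    have hmul : (0 : ℤ) ≤ (a0 - 1) * (a1 - 1) := mul_nonneg (by linarith) (by linarith)
    linarith

/-- The hypercube is `n`-connected. -/
theorem HammingSeparated.card_add_dim_le : ∀ {n : ℕ} {A B : Finset (Fin n → Bool)},
    HammingSeparated A B → 1 ≤ A.card → 1 ≤ B.card → A.card + B.card + n ≤ 2 ^ n
  | 0, A, B, h, hA, hB => h.card_add_le
  | n + 1, A, B, h, hA, hB => by
    have hAc := card_cubeSlice_add A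
    have hBc := card_cubeSlice_add B
    have i0 := (h.slice false).card_add_dim_le
    have i1 := (h.slice true).card_add_dim_le
    have c0 := h.card_slice_add_le (b := false) (c := true) (by simp)
    have c1 := h.card_slice_add_le (b := true) (c := false) (by simp)
    generalize (cubeSlice false A).card = a0 at *
    generalize (cubeSlice true A).card = a1 at *
    generalize (cubeSlice false B).card = b0 at *
    generalize (cubeSlice true B).card = b1 at *
    rw [pow_succ]
    have hN : n < 2 ^ n := Nat.lt_two_pow_self
    have hN0 : n = 0 → 2 ^ n = 1 := by rintro rfl; rfl
    generalize 2 ^ n = N at *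
    by_cases h0 : 1 ≤ a0 ∧ 1 ≤ b0
    · have := i0 h0.1 h0.2
      by_cases h1 : 1 ≤ a1 ∧ 1 ≤ b1
      · have := i1 h1.1 h1.2
        omega
      · omega
    · by_cases h1 : 1 ≤ a1 ∧ 1 ≤ b1
      · have := i1 h1.1 h1.2
        omega
      · omega

/-- Settles the cases where the separator has more than 2 ^ m - k vertices, m being the slice
dimension. -/
theorem choose_two_add_le_two_pow : ∀ {m : ℕ}, 3 ≤ m → (m + 1) * m + 2 * m ≤ 2 * 2 ^ m + 2
  | 3, _ => by norm_num
  | m + 4, _ => by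
    have := choose_two_add_le_two_pow (m := m + 3) (by omega)
    rw [pow_succ]
    nlinarith

/-- Vertices of a hypercube whose removal leaves `k ≤ n - 2` or more vertices on both sides number
at least `k n - k (k + 1) / 2 + 1`. -/
theorem HammingSeparated.card_add_le_of_le_card : ∀ {n : ℕ} {A B : Finset (Fin n → Bool)},
    HammingSeparated A B → ∀ k : ℕ, 1 ≤ k → k + 2 ≤ n → k ≤ A.card → k ≤ B.card →
    2 * (A.card + B.card : ℤ) + 2 * k * n - k * (k + 1) + 2 ≤ 2 * 2 ^ n
  | 0, A, B, h, k, hk, hkn, hA, hB => by omega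
  | m + 1, A, B, h, k, hk, hkn, hA, hB => by
    rcases Nat.eq_or_lt_of_le hk with rfl | hk2
    · have := h.card_add_dim_le hA hB
      zify at this
      push_cast at *
      linarith
    by_cases hAk : A.card = k
    · have := h.card_add_le_of_card (by omega)
      rwa [hAk] at this ⊢
    by_cases hBk : B.card = k
    · have := h.symm.card_add_le_of_card (by omega)
      rw [hBk] at this ⊢
      linarith
    have hAc := card_cubeSlice_add A
    have hBc := card_cubeSlice_add B
    have i0 := (h.slice false).card_add_le_of_le_card
    have i1 := (h.slice true).card_add_le_of_le_card
    have c0 := h.card_slice_add_le (b := false) (c := true) (by simp)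
    have c1 := h.card_slice_add_le (b := true) (c := false) (by simp)
    generalize (cubeSlice false A).card = a0 at *
    generalize (cubeSlice true A).card = a1 at *
    generalize (cubeSlice false B).card = b0 at *
    generalize (cubeSlice true B).card = b1 at *
    have hN := choose_two_add_le_two_pow (m := m) (by omega)
    have big : (k : ℤ) * (2 * m - k + 3) ≤ (m + 1) * m + 2 * m - 2 := by
      have h1 : (k : ℤ) ≤ m - 1 := by omega
      nlinarith
    rw [pow_succ]
    have hNZ : ((2 ^ m : ℕ) : ℤ) = 2 ^ m := by push_cast; rfl
    rw [← hNZ] at i0 i1 ⊢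
    clear hNZ
    generalize 2 ^ m = N at *
    zify at hN
    push_cast
    -- small sets in different slices on opposite sides force a large separator
    have key : A.card + B.card < k + N →
        2 * (A.card + B.card : ℤ) + 2 * k * (m + 1) - k * (k + 1) + 2 ≤ 2 * (N * 2) := by
      intro h1
      zify at h1
      linarith
    -- one of the two sides avoids a slice
    have empty : ∀ {p q : ℕ}, (∀ k' : ℕ, 1 ≤ k' → k' + 2 ≤ m → k' ≤ p → k' ≤ q →
          2 * (p + q : ℤ) + 2 * k' * m - k' * (k' + 1) + 2 ≤ 2 * N) → k ≤ p → k ≤ q →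
        A.card + B.card + (k + 1) ≤ p + q + N →
        2 * (A.card + B.card : ℤ) + 2 * k * (m + 1) - k * (k + 1) + 2 ≤ 2 * (N * 2) := by
      intro p q i hp hq hs
      zify at hs
      by_cases hkm : k + 2 ≤ m
      · have := i k (by omega) hkm hp hq
        linarith
      -- For k = m - 1 induction only allows k - 1. The loss is recovered exactly, because the other
      -- slice supplies k + 1 separating vertices and not just k.
      · obtain ⟨j, rfl⟩ : ∃ j, k = j + 1 := ⟨k - 1, by omega⟩
        have hm : m = j + 2 := by omega
        have := i j (by omega) (by omega) (by omega) (by omega)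
        subst hm
        push_cast at *
        linarith
    rcases Nat.eq_zero_or_pos a0 with h0 | ha0
    · by_cases hb : k ≤ b1
      · exact empty i1 (by omega) hb (by omega)
      · exact key (by omega)
    rcases Nat.eq_zero_or_pos a1 with h0 | ha1
    · by_cases hb : k ≤ b0
      · exact empty i0 (by omega) hb (by omega)
      · exact key (by omega)
    rcases Nat.eq_zero_or_pos b0 with h0 | hb0
    · by_cases hb : k ≤ a1
      · exact empty i1 hb (by omega) (by omega)
      · exact key (by omega)
    rcases Nat.eq_zero_or_pos b1 with h0 | hb1
    · by_cases hb : k ≤ a0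
      · exact empty i0 hb (by omega) (by omega)
      · exact key (by omega)
    by_cases hkey : A.card + B.card < k + N
    · exact key hkey
    -- The failure of `hkey` with `c0`, `c1` gives a0 + b1 ≥ k and a1 + b0 ≥ k; hence what k0 leaves
    -- of k fits into the second slice of both sets.
    obtain ⟨k0, k1, hk0, hk1, rfl, h0⟩ : ∃ k0 k1 : ℕ, 1 ≤ k0 ∧ 1 ≤ k1 ∧ k = k0 + k1 ∧
        k0 + 2 ≤ m ∧ k1 + 2 ≤ m ∧ k0 ≤ a0 ∧ k0 ≤ b0 ∧ k1 ≤ a1 ∧ k1 ≤ b1 := by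
      refine ⟨min (min (min a0 b0) (m - 2)) (k - 1), k - min (min (min a0 b0) (m - 2)) (k - 1), ?_⟩
      omega
    have j0 := i0 k0 hk0 (by omega) (by omega) (by omega)
    have j1 := i1 k1 hk1 (by omega) (by omega) (by omega)
    zify at hk0 hk1 hAc hBc
    have hmul : (0 : ℤ) ≤ (k0 - 1) * (k1 - 1) := mul_nonneg (by linarith) (by linarith)
    rw [← hAc, ← hBc]
    push_cast
    linarith

/-- In a hypercube of dimension `n ≥ 7`, a separator both of whose sides have more vertices than a
closed ball of radius one has more than `n (n - 1) / 2` vertices. -/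
theorem HammingSeparated.card_add_lt {n : ℕ} {A B : Finset (Fin n → Bool)}
    (h : HammingSeparated A B) (hn : 7 ≤ n) (hA : n + 2 ≤ A.card) (hB : n + 2 ≤ B.card) :
    2 * (A.card + B.card) + n * (n - 1) + 2 ≤ 2 * 2 ^ n := by
  obtain ⟨m, rfl⟩ : ∃ m, n = m + 1 := ⟨n - 1, by omega⟩
  have hAc := card_cubeSlice_add A
  have hBc := card_cubeSlice_add B
  have i0 := (h.slice false).card_add_le_of_le_card
  have i1 := (h.slice true).card_add_le_of_le_card
  have c0 := h.card_slice_add_le (b := false) (c := true) (by simp)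
  have c1 := h.card_slice_add_le (b := true) (c := false) (by simp)
  generalize (cubeSlice false A).card = a0 at *
  generalize (cubeSlice true A).card = a1 at *
  generalize (cubeSlice false B).card = b0 at *
  generalize (cubeSlice true B).card = b1 at *
  have hN : (m + 1) * m + 2 * m ≤ 2 * 2 ^ m := by
    obtain ⟨j, rfl⟩ : ∃ j, m = j + 1 := ⟨m - 1, by omega⟩
    have := choose_two_add_le_two_pow (m := j) (by omega)
    rw [pow_succ]
    nlinarith
  rw [pow_succ]
  have hNZ : ((2 ^ m : ℕ) : ℤ) = 2 ^ m := by push_cast; rfl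
  rw [← hNZ] at i0 i1
  clear hNZ
  generalize 2 ^ m = N at *
  have key : A.card + B.card < m + N →
      2 * (A.card + B.card) + (m + 1) * (m + 1 - 1) + 2 ≤ 2 * (N * 2) := by
    intro h1
    rw [Nat.add_sub_cancel]
    omega
  by_cases hkey : A.card + B.card < m + N
  · exact key hkey
  clear key
  -- The bound at k' = m - 2 plus m + 1 separating vertices in the other slice is exactly m (m + 1)
  -- / 2 + 1. The hypothesis n + 2 provides those m + 1 even if one vertex lies in the sparse slice.
  have small : ∀ {p q : ℕ}, (∀ k' : ℕ, 1 ≤ k' → k' + 2 ≤ m → k' ≤ p → k' ≤ q →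
        2 * (p + q : ℤ) + 2 * k' * m - k' * (k' + 1) + 2 ≤ 2 * N) → m - 2 ≤ p → m - 2 ≤ q →
      A.card + B.card + (m + 1) ≤ p + q + N →
      2 * (A.card + B.card) + (m + 1) * (m + 1 - 1) + 2 ≤ 2 * (N * 2) := by
    intro p q i hp hq hs
    obtain ⟨j, rfl⟩ : ∃ j, m = j + 2 := ⟨m - 2, by omega⟩
    have := i j (by omega) (by omega) (by omega) (by omega)
    rw [Nat.add_sub_cancel]
    zify at hs ⊢
    push_cast at *
    linarith
  by_cases ha0 : a0 ≤ 1
  · exact small i1 (by omega) (by omega) (by omega)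
  by_cases ha1 : a1 ≤ 1
  · exact small i0 (by omega) (by omega) (by omega)
  by_cases hb0 : b0 ≤ 1
  · exact small i1 (by omega) (by omega) (by omega)
  by_cases hb1 : b1 ≤ 1
  · exact small i0 (by omega) (by omega) (by omega)
  -- Now k = n - 1 = m is split. All four slices have at least two points, so both parts can be kept
  -- at most m - 2.
  obtain ⟨k0, k1, hk0, hk1, hk, h0⟩ : ∃ k0 k1 : ℕ, 1 ≤ k0 ∧ 1 ≤ k1 ∧ m = k0 + k1 ∧
      k0 + 2 ≤ m ∧ k1 + 2 ≤ m ∧ k0 ≤ a0 ∧ k0 ≤ b0 ∧ k1 ≤ a1 ∧ k1 ≤ b1 := by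
    refine ⟨min (min a0 b0) (m - 2), m - min (min a0 b0) (m - 2), ?_⟩
    omega
  have j0 := i0 k0 hk0 (by omega) (by omega) (by omega)
  have j1 := i1 k1 hk1 (by omega) (by omega) (by omega)
  rw [Nat.add_sub_cancel]
  zify at hk0 hk1 hAc hBc ⊢
  have hmul : (0 : ℤ) ≤ (k0 - 1) * (k1 - 1) := mul_nonneg (by linarith) (by linarith)
  rw [← hAc, ← hBc]
  subst hk
  push_cast at *
  linarith

end Isoperimetry

/-! ### Short cycles and common neighbours in the folded hypercube. -/

section LocalStructure

variable {n : ℕ}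

theorem hammingDist_bool_not (u v : Fin n → Bool) :
    hammingDist u (fun i => !v i) + hammingDist u v = n := by
  have h := Finset.card_filter_add_card_filter_not (s := (Finset.univ : Finset (Fin n)))
    (fun i => u i ≠ v i)
  rw [Finset.card_univ, Fintype.card_fin] at h
  rw [add_comm]
  refine Eq.trans ?_ h
  rw [hammingDist, hammingDist]
  congr 2
  ext i
  simp only [Finset.mem_filter, Finset.mem_univ, true_and]
  cases u i <;> cases v i <;> simp

theorem even_hammingDist_add (u v w : Fin n → Bool) :
    Even (hammingDist u v + hammingDist v w + hammingDist u w) := by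
  simp only [hammingDist, Finset.card_filter, ← Finset.sum_add_distrib]
  refine Finset.even_sum _ fun i _ => ?_
  cases u i <;> cases v i <;> cases w i <;> decide

/-- The neighbour of `v` in the direction `s`, where `none` stands for complementation. -/
def foldedNeighbor (s : Option (Fin n)) (v : Fin n → Bool) : Fin n → Bool :=
  s.elim (fun i => !v i) fun i => Function.update v i (!v i)

theorem foldedNeighbor_none (v : Fin n → Bool) : foldedNeighbor none v = fun i => !v i := rfl

theorem foldedNeighbor_some (i : Fin n) (v : Fin n → Bool) :
    foldedNeighbor (some i) v = Function.update v i (!v i) := rfl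

theorem hammingDist_update_not (v : Fin n → Bool) (i : Fin n) :
    hammingDist v (Function.update v i (!v i)) = 1 := by
  rw [hammingDist, Finset.card_eq_one]
  refine ⟨i, Finset.ext fun j => ?_⟩
  by_cases h : j = i
  · subst h; simp
  · simp [h]

theorem exists_eq_update_not {u v : Fin n → Bool} (h : hammingDist u v = 1) :
    ∃ i, u i ≠ v i ∧ v = Function.update u i (!u i) := by
  obtain ⟨i, hi⟩ := Finset.card_eq_one.1 h
  have hi' : ∀ j, u j ≠ v j ↔ j = i := fun j => by
    have := Finset.ext_iff.1 hi j
    simpa using this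
  refine ⟨i, (hi' i).2 rfl, funext fun j => ?_⟩
  by_cases h : j = i
  · subst h
    have := (hi' j).2 rfl
    simp only [Function.update_self]
    revert this
    cases u j <;> cases v j <;> simp
  · have := (not_congr (hi' j)).2 h
    simp only [ne_eq, not_not] at this
    simp [h, this]

theorem foldedHypercube_adj_iff (hn : 2 ≤ n) (u v : Fin n → Bool) :
    (foldedHypercube n).Adj u v ↔ hammingDist u v = 1 ∨ v = fun i => !u i := by
  simp only [foldedHypercube, SimpleGraph.sup_adj, SimpleGraph.fromRel_adj]
  refine or_congr Iff.rfl ⟨?_, ?_⟩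
  · rintro ⟨-, h | h⟩
    · exact h
    · subst h; simp
  · intro h
    refine ⟨?_, Or.inl h⟩
    rintro rfl
    have := congrFun h ⟨0, by omega⟩
    revert this
    cases u ⟨0, by omega⟩ <;> simp

theorem foldedHypercube_adj_iff_exists (hn : 2 ≤ n) (u v : Fin n → Bool) :
    (foldedHypercube n).Adj u v ↔ ∃ s, v = foldedNeighbor s u := by
  rw [foldedHypercube_adj_iff hn]
  constructor
  · rintro (h | h)
    · obtain ⟨i, -, h⟩ := exists_eq_update_not h
      exact ⟨some i, h⟩
    · exact ⟨none, h⟩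
  · rintro ⟨_ | i, rfl⟩
    · exact Or.inr rfl
    · exact Or.inl (hammingDist_update_not u i)

theorem foldedNeighbor_injective (hn : 3 ≤ n) (v : Fin n → Bool) :
    Function.Injective fun s => foldedNeighbor s v := by
  have h1 : ∀ i, foldedNeighbor none v ≠ foldedNeighbor (some i) v := by
    intro i h
    have h2 := hammingDist_update_not v i
    rw [← foldedNeighbor_some, ← h, foldedNeighbor_none] at h2
    have := hammingDist_bool_not v v
    simp at this
    omega
  rintro (_ | i) (_ | j) h
  · rfl
  · exact (h1 j h).elim
  · exact (h1 i h.symm).elim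
  · by_contra hij
    have hij : i ≠ j := fun h => hij (by rw [h])
    have := congrFun h i
    simp [foldedNeighbor_some, hij] at this

theorem foldedNeighbor_comm (s t : Option (Fin n)) (v : Fin n → Bool) :
    foldedNeighbor s (foldedNeighbor t v) = foldedNeighbor t (foldedNeighbor s v) := by
  rcases s with _ | i <;> rcases t with _ | j
  · rfl
  · funext k
    by_cases h : k = j <;> simp [foldedNeighbor, Function.update_apply, h]
  · funext k
    by_cases h : k = i <;> simp [foldedNeighbor, Function.update_apply, h]
  · funext k
    by_cases h : k = i <;> by_cases h' : k = j <;>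
      simp_all [foldedNeighbor, Function.update_apply]

theorem foldedNeighbor_foldedNeighbor (s : Option (Fin n)) (v : Fin n → Bool) :
    foldedNeighbor s (foldedNeighbor s v) = v := by
  rcases s with _ | i <;> simp [foldedNeighbor]

/-- A necessary condition for a walk of length `k` in the folded hypercube between `u` and `v`. -/
def FoldedReach (k : ℕ) (u v : Fin n → Bool) : Prop :=
  (hammingDist u v ≤ k ∧ Even (k + hammingDist u v)) ∨
    (n < hammingDist u v + k ∧ Odd (k + n + hammingDist u v))

theorem foldedReach_self (u : Fin n → Bool) : FoldedReach 0 u u := by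
  simp [FoldedReach]

/-- The two alternatives record whether the walk used an even or an odd number of complementations;
in the odd case n - d ≤ k - 1, with matching parity, where d is the Hamming distance. -/
theorem FoldedReach.step (hn : 2 ≤ n) {k : ℕ} {u v w : Fin n → Bool} (h : FoldedReach k u v)
    (hvw : (foldedHypercube n).Adj v w) : FoldedReach (k + 1) u w := by
  rw [foldedHypercube_adj_iff hn] at hvw
  simp only [FoldedReach, Nat.even_iff, Nat.odd_iff] at *
  have hle : hammingDist u v ≤ n := by simpa using hammingDist_le_card_fintype (x := u) (y := v)
  rcases hvw with hvw | rfl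
  · have h1 := hammingDist_triangle u v w
    have h2 := hammingDist_triangle u w v
    have h3 := Nat.even_iff.1 (even_hammingDist_add u v w)
    rw [hammingDist_comm w v] at h2
    omega
  · have := hammingDist_bool_not u v
    omega

/-- A closed walk of odd length must complement an odd number of times, which forces length above n.
-/
theorem FoldedReach.ne (hn : 7 ≤ n) {k : ℕ} (hk : k = 3 ∨ k = 5) {u v : Fin n → Bool}
    (h : FoldedReach k u v) : u ≠ v := by
  rintro rfl
  simp only [FoldedReach, hammingDist_self, Nat.even_iff, Nat.odd_iff] at h
  omega

theorem foldedHypercube_no_triangle (hn : 7 ≤ n) {u v w : Fin n → Bool}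
    (h1 : (foldedHypercube n).Adj u v) (h2 : (foldedHypercube n).Adj v w) :
    ¬ (foldedHypercube n).Adj w u := fun h3 =>
  have hn2 : 2 ≤ n := by omega
  ((((foldedReach_self u).step hn2 h1).step hn2 h2).step hn2 h3).ne hn (Or.inl rfl) rfl

theorem foldedHypercube_no_pentagon (hn : 7 ≤ n) {u v w x y : Fin n → Bool}
    (h1 : (foldedHypercube n).Adj u v) (h2 : (foldedHypercube n).Adj v w)
    (h3 : (foldedHypercube n).Adj w x) (h4 : (foldedHypercube n).Adj x y) :
    ¬ (foldedHypercube n).Adj y u := fun h5 =>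
  have hn2 : 2 ≤ n := by omega
  ((((((foldedReach_self u).step hn2 h1).step hn2 h2).step hn2 h3).step hn2 h4).step hn2 h5).ne hn
    (Or.inr rfl) rfl

/-- Two vertices of the folded hypercube have at most two common neighbours. -/
theorem foldedHypercube_card_common_le (hn : 7 ≤ n) {u v : Fin n → Bool} (huv : u ≠ v)
    (S : Finset (Fin n → Bool))
    (hS : ∀ w ∈ S, (foldedHypercube n).Adj u w ∧ (foldedHypercube n).Adj v w) : S.card ≤ 2 := by
  -- A common neighbour along two hypercube edges forces distance 2; at any other distance one of
  -- the edges is a complementation.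
  by_cases h2 : hammingDist u v = 2
  · refine (Finset.card_le_card (t := (Finset.univ.filter fun i => u i ≠ v i).image
      fun i => foldedNeighbor (some i) u) fun w hw => ?_).trans (Finset.card_image_le.trans h2.le)
    obtain ⟨h3, h4⟩ := hS w hw
    rw [foldedHypercube_adj_iff (by omega)] at h3 h4
    rw [hammingDist_comm] at h2
    have h6 := hammingDist_comm u v
    rcases h3 with h3 | rfl
    · have h7 := hammingDist_triangle v u w
      have h8 := hammingDist_bool_not v v
      rw [hammingDist_self] at h8
      obtain ⟨i, hi, rfl⟩ := exists_eq_update_not h3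
      refine Finset.mem_image.2 ⟨i, ?_, rfl⟩
      simp only [Finset.mem_filter, Finset.mem_univ, true_and]
      intro hi'
      rcases h4 with h4 | h4
      · obtain ⟨j, hj, h5⟩ := exists_eq_update_not h4
        have hji : i = j := by
          by_contra hij
          have := congrFun h5 i
          simp [hij, ← hi'] at this
        subst hji
        have : u = v := by
          funext k
          by_cases hk : k = i
          · rw [hk, hi']
          · simpa [hk] using congrFun h5 k
        exact absurd this huv
      · rw [h4] at h7 h3
        omega
    · have := hammingDist_bool_not v u
      rcases h4 with h4 | h4
      · omega
      · refine absurd (funext fun i => ?_) huv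
        simpa using congrFun h4 i
  · refine (Finset.card_le_card (t := {fun i => !u i, fun i => !v i}) fun w hw => ?_).trans
      Finset.card_le_two
    obtain ⟨h3, h4⟩ := hS w hw
    rw [foldedHypercube_adj_iff (by omega)] at h3 h4
    rcases h3 with h3 | rfl
    · rcases h4 with h4 | rfl
      · have h5 := hammingDist_triangle u w v
        have h6 := Nat.even_iff.1 (even_hammingDist_add u w v)
        rw [hammingDist_comm w v, h3, h4] at h5 h6
        have := hammingDist_pos.2 huv
        omega
      · simp
    · simp

end LocalStructure

/-! ### How few neighbours a star can cover, and the lower bound. -/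

section StarsInFoldedHypercube

variable {n : ℕ}

/-- `c ∈ S` and every other element of `S` is a neighbour of `c`. -/
def IsStarAt {V : Type*} (G : SimpleGraph V) (c : V) (S : Finset V) : Prop :=
  c ∈ S ∧ ∀ w ∈ S, w ≠ c → G.Adj c w

theorem foldedHypercube_card_neighborFinset (hn : 3 ≤ n) (v : Fin n → Bool)
    [Fintype ((foldedHypercube n).neighborSet v)] :
    ((foldedHypercube n).neighborFinset v).card = n + 1 := by
  have h : (foldedHypercube n).neighborFinset v =
      Finset.univ.image fun s => foldedNeighbor s v := by
    ext w
    simp only [SimpleGraph.mem_neighborFinset, Finset.mem_image, Finset.mem_univ, true_and]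
    rw [foldedHypercube_adj_iff_exists (by omega)]
    simp only [eq_comm]
  rw [h, Finset.card_image_of_injective _ (foldedNeighbor_injective hn v)]
  simp

open Classical in
theorem IsStarAt.card_inter_neighbor_le (hn : 7 ≤ n) {c u : Fin n → Bool}
    {S : Finset (Fin n → Bool)} (hS : IsStarAt (foldedHypercube n) c S) (hu : u ∉ S) :
    (S.filter fun w => (foldedHypercube n).Adj u w).card ≤ 2 := by
  by_cases hcu : (foldedHypercube n).Adj c u
  · refine (Finset.card_le_card (t := {c}) fun w hw => ?_).trans (by simp)
    obtain ⟨hw, huw⟩ := Finset.mem_filter.1 hw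
    by_contra hwc
    exact foldedHypercube_no_triangle hn hcu huw (hS.2 w hw (by simpa using hwc)).symm
  · refine foldedHypercube_card_common_le hn (u := c) (v := u) ?_ _ fun w hw => ?_
    · rintro rfl
      exact hu hS.1
    · obtain ⟨hw, huw⟩ := Finset.mem_filter.1 hw
      refine ⟨hS.2 w hw ?_, huw⟩
      rintro rfl
      exact hcu huw.symm

open Classical in
-- If c is adjacent to u, then u is itself one of the at most two common neighbours of c and v, so
-- besides c at most one leaf counts. If c is adjacent to neither end, leaves next to u and next to
-- v would close a pentagon, so only one end matters.
theorem IsStarAt.card_inter_neighbor_pair_le (hn : 7 ≤ n) {c u v : Fin n → Bool}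
    {S : Finset (Fin n → Bool)} (hS : IsStarAt (foldedHypercube n) c S) (hu : u ∉ S) (hv : v ∉ S)
    (huv : (foldedHypercube n).Adj u v) :
    (S.filter fun w => (foldedHypercube n).Adj u w ∨ (foldedHypercube n).Adj v w).card ≤ 2 := by
  have near : ∀ {u v : Fin n → Bool}, u ∉ S → v ∉ S → (foldedHypercube n).Adj u v →
      (foldedHypercube n).Adj c u →
      (S.filter fun w => (foldedHypercube n).Adj u w ∨ (foldedHypercube n).Adj v w).card ≤ 2 := by
    intro u v hu hv huv hcu
    have hcv : c ≠ v := by rintro rfl; exact hv hS.1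
    set C := S.filter fun w => (foldedHypercube n).Adj c w ∧ (foldedHypercube n).Adj v w with hC
    have hC1 : C.card + 1 ≤ 2 := by
      rw [← Finset.card_insert_of_notMem (a := u) (s := C) (by simp [hC, hu])]
      refine foldedHypercube_card_common_le hn hcv _ fun w hw => ?_
      rcases Finset.mem_insert.1 hw with rfl | hw
      · exact ⟨hcu, huv.symm⟩
      · exact (Finset.mem_filter.1 hw).2
    refine (Finset.card_le_card (t := insert c C) fun w hw => ?_).trans
      ((Finset.card_insert_le _ _).trans hC1)
    obtain ⟨hw, huvw⟩ := Finset.mem_filter.1 hw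
    rw [Finset.mem_insert, or_iff_not_imp_left]
    intro hwc
    have hcw := hS.2 w hw hwc
    rcases huvw with huw | hvw
    · exact (foldedHypercube_no_triangle hn hcu huw hcw.symm).elim
    · exact Finset.mem_filter.2 ⟨hw, hcw, hvw⟩
  by_cases hcu : (foldedHypercube n).Adj c u
  · exact near hu hv huv hcu
  by_cases hcv : (foldedHypercube n).Adj c v
  · simpa only [or_comm] using near hv hu huv.symm hcv
  have far : ∀ {w}, w ∈ S → (foldedHypercube n).Adj u w ∨ (foldedHypercube n).Adj v w →
      (foldedHypercube n).Adj c w := by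
    intro w hw h
    refine hS.2 w hw ?_
    rintro rfl
    exact h.elim (fun h => hcu h.symm) fun h => hcv h.symm
  by_cases hex : ∃ w ∈ S, (foldedHypercube n).Adj v w
  · obtain ⟨x, hx, hvx⟩ := hex
    refine (Finset.card_le_card fun w hw => ?_).trans (hS.card_inter_neighbor_le hn hv)
    obtain ⟨hw, huvw⟩ := Finset.mem_filter.1 hw
    refine Finset.mem_filter.2 ⟨hw, huvw.resolve_left fun huw => ?_⟩
    exact foldedHypercube_no_pentagon hn (far hw (Or.inl huw)) huw.symm huv hvx
      (far hx (Or.inr hvx)).symm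
  · refine (Finset.card_le_card fun w hw => ?_).trans (hS.card_inter_neighbor_le hn hu)
    obtain ⟨hw, huvw⟩ := Finset.mem_filter.1 hw
    exact Finset.mem_filter.2 ⟨hw, huvw.resolve_right fun h => hex ⟨w, hw, h⟩⟩

theorem card_biUnion_filter_le {V : Type*} [DecidableEq V] (𝓢 : Finset (Finset V)) (p : V → Prop)
    [DecidablePred p] (k : ℕ) (h : ∀ S ∈ 𝓢, (S.filter p).card ≤ k) :
    ((𝓢.biUnion id).filter p).card ≤ 𝓢.card * k := by
  rw [Finset.filter_biUnion]
  exact Finset.card_biUnion_le_card_mul _ _ _ h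

open Classical in
/-- If at most `n / 2` stars are deleted from `FQ_n`, then a nonempty union of components of the
rest has at least `n + 2` vertices. -/
theorem card_ge_of_neighbors_subset (hn : 7 ≤ n) (𝓢 : Finset (Finset (Fin n → Bool)))
    (h𝓢 : ∀ S ∈ 𝓢, ∃ c, IsStarAt (foldedHypercube n) c S) (hcard : 𝓢.card ≤ n / 2)
    (A : Finset (Fin n → Bool)) (hA : A.Nonempty) (hdisj : ∀ v ∈ A, v ∉ 𝓢.biUnion id)
    (hnbr : ∀ u ∈ A, ∀ v, (foldedHypercube n).Adj u v → v ∈ A ∨ v ∈ 𝓢.biUnion id) :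
    n + 2 ≤ A.card := by
  have hout : ∀ v ∈ A, ∀ S ∈ 𝓢, v ∉ S := fun v hv S hS h =>
    hdisj v hv (Finset.mem_biUnion.2 ⟨S, hS, h⟩)
  obtain ⟨u, hu⟩ := hA
  obtain ⟨v, hv, huv⟩ : ∃ v ∈ A, (foldedHypercube n).Adj u v := by
    -- Otherwise all n + 1 neighbours of u are deleted, at most two by each star.
    by_contra! hno
    have h1 := foldedHypercube_card_neighborFinset (by omega) u
    have h2 := card_biUnion_filter_le 𝓢 (fun w => (foldedHypercube n).Adj u w) 2 fun S hS => by
      obtain ⟨c, hc⟩ := h𝓢 S hS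
      exact hc.card_inter_neighbor_le hn (hout u hu S hS)
    have h3 : (foldedHypercube n).neighborFinset u ⊆
        (𝓢.biUnion id).filter fun w => (foldedHypercube n).Adj u w := by
      intro w hw
      rw [SimpleGraph.mem_neighborFinset] at hw
      exact Finset.mem_filter.2 ⟨(hnbr u hu w hw).resolve_left fun h => hno w h hw, hw⟩
    have := Finset.card_le_card h3
    omega
  have h1 := foldedHypercube_card_neighborFinset (by omega) u
  have h2 := foldedHypercube_card_neighborFinset (by omega) v
  have h3 := card_biUnion_filter_le 𝓢
    (fun w => (foldedHypercube n).Adj u w ∨ (foldedHypercube n).Adj v w) 2 fun S hS => by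
      obtain ⟨c, hc⟩ := h𝓢 S hS
      exact hc.card_inter_neighbor_pair_le hn (hout u hu S hS) (hout v hv S hS) huv
  have h4 : Disjoint ((foldedHypercube n).neighborFinset u)
      ((foldedHypercube n).neighborFinset v) := by
    refine Finset.disjoint_left.2 fun w hw hw' => ?_
    rw [SimpleGraph.mem_neighborFinset] at hw hw'
    exact foldedHypercube_no_triangle hn huv hw' hw.symm
  have h5 : (foldedHypercube n).neighborFinset u ∪ (foldedHypercube n).neighborFinset v ⊆
      A ∪ (𝓢.biUnion id).filter
        fun w => (foldedHypercube n).Adj u w ∨ (foldedHypercube n).Adj v w := by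
    intro w hw
    rw [Finset.mem_union, SimpleGraph.mem_neighborFinset, SimpleGraph.mem_neighborFinset] at hw
    rw [Finset.mem_union, Finset.mem_filter]
    have : w ∈ A ∨ w ∈ 𝓢.biUnion id := hw.elim (hnbr u hu w) (hnbr v hv w)
    tauto
  have h6 := (Finset.card_le_card h5).trans (Finset.card_union_le _ _)
  rw [Finset.card_union_of_disjoint h4] at h6
  omega

open Classical in
/-- Deleting at most `n / 2` stars with at most `r + 1` vertices each leaves `FQ_n` connected. -/
theorem preconnected_induce_compl_of_stars (hn : 7 ≤ n) {r : ℕ}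
    (hrn : n / 2 * (r + 1) * 2 ≤ n * (n - 1))
    (𝓢 : Finset (Finset (Fin n → Bool)))
    (h𝓢 : ∀ S ∈ 𝓢, (∃ c, IsStarAt (foldedHypercube n) c S) ∧ S.card ≤ r + 1)
    (hcard : 𝓢.card ≤ n / 2) (X : Set (Fin n → Bool)) (hX : ∀ v, v ∈ X ↔ v ∈ 𝓢.biUnion id) :
    ((foldedHypercube n).induce Xᶜ).Preconnected := by
  intro a b
  by_contra hab
  set G := (foldedHypercube n).induce Xᶜ with hG
  let A : Finset (Fin n → Bool) := Finset.univ.filter fun v => ∃ h : v ∈ Xᶜ, G.Reachable a ⟨v, h⟩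
  let B : Finset (Fin n → Bool) :=
    Finset.univ.filter fun v => ∃ h : v ∈ Xᶜ, ¬ G.Reachable a ⟨v, h⟩
  have mA : ∀ v, v ∈ A ↔ ∃ h : v ∈ Xᶜ, G.Reachable a ⟨v, h⟩ := by simp [A]
  have mB : ∀ v, v ∈ B ↔ ∃ h : v ∈ Xᶜ, ¬ G.Reachable a ⟨v, h⟩ := by simp [B]
  have hAB : ∀ u ∈ A, ∀ v ∈ B, ¬ (foldedHypercube n).Adj u v := by
    intro u hu v hv huv
    obtain ⟨hu, hu'⟩ := (mA u).1 hu
    obtain ⟨hv, hv'⟩ := (mB v).1 hv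
    exact hv' (hu'.trans
      (SimpleGraph.Adj.reachable (G := G) (u := (⟨u, hu⟩ : ↥Xᶜ)) (v := (⟨v, hv⟩ : ↥Xᶜ)) huv))
  have hdisj : ∀ v ∈ A, v ∉ B := by
    intro v hv hv'
    obtain ⟨_, h1⟩ := (mA v).1 hv
    obtain ⟨_, h2⟩ := (mB v).1 hv'
    exact h2 h1
  have hcov : ∀ v, v ∈ A ∨ v ∈ B ∨ v ∈ 𝓢.biUnion id := by
    intro v
    rw [mA, mB, ← hX]
    by_cases h : v ∈ X
    · exact Or.inr (Or.inr h)
    · by_cases h' : G.Reachable a ⟨v, h⟩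
      · exact Or.inl ⟨h, h'⟩
      · exact Or.inr (Or.inl ⟨h, h'⟩)
  have hA := card_ge_of_neighbors_subset hn 𝓢 (fun S hS => (h𝓢 S hS).1) hcard A
    ⟨a, (mA _).2 ⟨a.2, SimpleGraph.Reachable.refl _⟩⟩
    (fun v hv => by rw [← hX]; exact ((mA v).1 hv).1)
    (fun u hu v huv => (hcov v).imp_right fun h => h.resolve_left fun hv => hAB u hu v hv huv)
  have hB := card_ge_of_neighbors_subset hn 𝓢 (fun S hS => (h𝓢 S hS).1) hcard B
    ⟨b, (mB _).2 ⟨b.2, hab⟩⟩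
    (fun v hv => by rw [← hX]; exact ((mB v).1 hv).1)
    (fun u hu v huv => (hcov v).resolve_left fun hv => hAB v hv u hu huv.symm)
  have hsep : HammingSeparated A B := by
    intro u hu v hv
    have h0 : hammingDist u v ≠ 0 := by
      rw [hammingDist_ne_zero]
      rintro rfl
      exact hdisj u hu hv
    have h1 : hammingDist u v ≠ 1 := fun h =>
      hAB u hu v hv ((foldedHypercube_adj_iff (by omega) u v).2 (Or.inl h))
    omega
  have hmain := hsep.card_add_lt hn hA hB
  have huniv : 2 ^ n ≤ A.card + B.card + (𝓢.biUnion id).card := by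
    have h1 : (Finset.univ : Finset (Fin n → Bool)) ⊆ A ∪ B ∪ 𝓢.biUnion id := by
      intro v _
      simpa only [Finset.mem_union, or_assoc] using hcov v
    have h2 := (Finset.card_le_card h1).trans
      ((Finset.card_union_le _ _).trans (Nat.add_le_add_right (Finset.card_union_le _ _) _))
    simpa using h2
  have hXc : (𝓢.biUnion id).card ≤ 𝓢.card * (r + 1) :=
    Finset.card_biUnion_le_card_mul _ _ _ fun S hS => (h𝓢 S hS).2
  have := Nat.mul_le_mul_right (r + 1) hcard
  omega

/-- The centre is the hub if present; without it a connected subgraph is a single leaf. -/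
theorem exists_center_of_connected {r : ℕ} (T : (starK r).Subgraph) (hT : T.Connected) :
    ∃ c ∈ T.verts, ∀ v ∈ T.verts, v ≠ c → T.Adj c v := by
  have key : ∀ v ∈ T.verts, ∀ w ∈ T.verts, v ≠ w → ∃ x, T.Adj v x := by
    intro v hv w hw hvw
    obtain ⟨p⟩ := hT.coe.preconnected ⟨v, hv⟩ ⟨w, hw⟩
    cases p with
    | nil => exact (hvw rfl).elim
    | cons h _ => exact ⟨_, h⟩
  have leaf : ∀ i x, T.Adj (Sum.inr i) x → x = Sum.inl 0 := by
    intro i x h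
    have := h.adj_sub
    rcases x with x | x
    · rw [Subsingleton.elim x 0]
    · simp at this
  by_cases h0 : Sum.inl 0 ∈ T.verts
  · refine ⟨_, h0, fun v hv hv0 => ?_⟩
    rcases v with v | i
    · exact (hv0 (by rw [Subsingleton.elim v 0])).elim
    · obtain ⟨x, hx⟩ := key _ hv _ h0 hv0
      have := leaf i x hx
      subst this
      exact hx.symm
  · obtain ⟨c, hc⟩ := hT.nonempty
    refine ⟨c, hc, fun v hv hvc => ?_⟩
    obtain ⟨x, hx⟩ := key v hv c hc hvc
    rcases v with v | i
    · exact (h0 (by rwa [Subsingleton.elim v 0] at hv)).elim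
    · exact (h0 (leaf i x hx ▸ hx.snd_mem)).elim

open Classical in
theorem isStarAt_of_iso {V : Type*} [Fintype V] {G : SimpleGraph V} {r : ℕ} (H : G.Subgraph)
    (T : (starK r).Subgraph) (hT : T.Connected) (e : H.coe ≃g T.coe) :
    (∃ c, IsStarAt G c H.verts.toFinset) ∧ H.verts.toFinset.card ≤ r + 1 := by
  constructor
  · obtain ⟨c, hc, h⟩ := exists_center_of_connected T hT
    refine ⟨e.symm ⟨c, hc⟩, by simp, fun w hw hwc => ?_⟩
    have hw' : w ∈ H.verts := by simpa using hw
    have h1 : H.coe.Adj (e.symm ⟨c, hc⟩) ⟨w, hw'⟩ := by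
      rw [← e.map_adj_iff, RelIso.apply_symm_apply]
      refine h _ (e ⟨w, hw'⟩).2 fun h2 => hwc ?_
      have h3 : e ⟨w, hw'⟩ = ⟨c, hc⟩ := Subtype.ext h2
      rw [← h3, RelIso.symm_apply_apply]
    exact H.adj_sub h1
  · rw [Set.toFinset_card, Fintype.card_congr e.toEquiv]
    refine (Fintype.card_subtype_le _).trans ?_
    simp [add_comm]

end StarsInFoldedHypercube

/-! ### The explicit cut, and arithmetic of the threshold. -/

section StarCut

variable {n r : ℕ}

theorem exists_star_subgraph {V : Type*} {G : SimpleGraph V} (c : V) (L : Finset V)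
    (hL : L.card = r) (hcL : ∀ v ∈ L, G.Adj c v) :
    ∃ H : G.Subgraph, Nonempty (H.coe ≃g starK r) ∧ H.verts = insert c (L : Set V) := by
  let e : L ≃ Fin r := L.equivFinOfCardEq hL
  let f : Fin 1 ⊕ Fin r → V := Sum.elim (fun _ => c) fun i => (e.symm i : V)
  have hf : Function.Injective f := by
    refine Function.Injective.sumElim (Function.injective_of_subsingleton _)
      (Subtype.val_injective.comp e.symm.injective) fun _ i => ?_
    exact (hcL _ (e.symm i).2).ne
  let φ : SimpleGraph.Copy (starK r) G := ⟨⟨f, by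
    rintro (a | i) (b | j) h
    · simp at h
    · exact hcL _ (e.symm j).2
    · exact (hcL _ (e.symm i).2).symm
    · simp at h⟩, hf⟩
  refine ⟨φ.toSubgraph, ⟨φ.isoToSubgraph.symm⟩, ?_⟩
  have h1 : φ.toSubgraph.verts = Set.range f := by
    simp [SimpleGraph.Copy.toSubgraph]
    rfl
  rw [h1, Set.Sum.elim_range, Set.range_const, Set.singleton_union]
  congr 1
  ext v
  constructor
  · rintro ⟨i, rfl⟩
    exact (e.symm i).2
  · intro hv
    exact ⟨e ⟨v, hv⟩, by simp⟩

/-- Two neighbours of `u` lie in a common star that avoids `u` and `z`. -/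
theorem exists_star_through_neighbors (hn : 7 ≤ n) (hr : 2 ≤ r) (hrn : r ≤ n + 1)
    {u z : Fin n → Bool} (hz : ¬ FoldedReach 2 u z) (hz' : ¬ FoldedReach 3 u z)
    {s t : Option (Fin n)} (hst : s ≠ t) :
    ∃ H : (foldedHypercube n).Subgraph, Nonempty (H.coe ≃g starK r) ∧ u ∉ H.verts ∧ z ∉ H.verts ∧
      foldedNeighbor s u ∈ H.verts ∧ foldedNeighbor t u ∈ H.verts := by
  classical
  have hn2 : 2 ≤ n := by omega
  have adj : ∀ s v, (foldedHypercube n).Adj v (foldedNeighbor s v) := fun s v =>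
    (foldedHypercube_adj_iff_exists hn2 _ _).2 ⟨s, rfl⟩
  -- The common neighbour, other than u, of the two given neighbours.
  set c := foldedNeighbor s (foldedNeighbor t u) with hc
  have h2 : FoldedReach 2 u c := ((foldedReach_self u).step hn2 (adj t u)).step hn2 (adj s _)
  have hcs : (foldedHypercube n).Adj c (foldedNeighbor s u) := by
    rw [hc, foldedNeighbor_comm]
    exact (adj t _).symm
  have hct : (foldedHypercube n).Adj c (foldedNeighbor t u) := (adj s _).symm
  have hne : foldedNeighbor s u ≠ foldedNeighbor t u := fun h =>
    hst (foldedNeighbor_injective (by omega) u h)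
  obtain ⟨L, hL1, hL2, hL⟩ := Finset.exists_subsuperset_card_eq
    (s := {foldedNeighbor s u, foldedNeighbor t u}) (t := (foldedHypercube n).neighborFinset c)
    (n := r) (by simp [Finset.insert_subset_iff, hcs, hct])
    (by rw [Finset.card_pair hne]; exact hr)
    (by rw [foldedHypercube_card_neighborFinset (by omega)]; exact hrn)
  have hcL : ∀ v ∈ L, (foldedHypercube n).Adj c v := fun v hv => by simpa using hL2 hv
  obtain ⟨H, hH, hHv⟩ := exists_star_subgraph c L hL hcL
  refine ⟨H, hH, ?_, ?_, ?_, ?_⟩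
  · rw [hHv]
    rintro (h | h)
    · refine hne ?_
      rw [← foldedNeighbor_foldedNeighbor s (foldedNeighbor t u), ← hc, ← h]
    · exact (h2.step hn2 (hcL _ h)).ne hn (Or.inl rfl) rfl
  · rw [hHv]
    rintro (h | h)
    · exact hz (h ▸ h2)
    · exact hz' (h2.step hn2 (hcL _ h))
  · rw [hHv]
    exact Or.inr (hL1 (by simp))
  · rw [hHv]
    exact Or.inr (hL1 (by simp))

theorem exists_structureCut (hn : 7 ≤ n) (hr : 2 ≤ r) (hrn : r ≤ n + 1) :
    ∃ F : Set (foldedHypercube n).Subgraph,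
      IsStructureCut (foldedHypercube n) (starK r) F ∧ F.encard ≤ ((n / 2 + 1 : ℕ) : ℕ∞) := by
  have hn2 : 2 ≤ n := by omega
  let u : Fin n → Bool := fun _ => false
  -- Weight 4 with n ≥ 7 puts z out of reach of u by walks of length at most 3, with or without
  -- complementation.
  let z : Fin n → Bool := fun i => decide (i.1 < 4)
  have huz : hammingDist u z = 4 := by
    have : (Finset.univ.filter fun i : Fin n => u i ≠ z i) =
        Finset.univ.map (Fin.castLEEmb (show 4 ≤ n by omega)) := by
      ext i
      simp only [u, z, Finset.mem_filter, Finset.mem_univ, true_and, Finset.mem_map]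
      constructor
      · intro h
        exact ⟨⟨i.1, by simpa using h⟩, rfl⟩
      · rintro ⟨j, rfl⟩
        simp
    rw [hammingDist, this]
    simp
  have hz : ∀ k ≤ 3, ¬ FoldedReach k u z := by
    intro k hk h
    simp only [FoldedReach, huz, Nat.even_iff, Nat.odd_iff] at h
    omega
  let e : Fin (n + 1) ≃ Option (Fin n) := finSuccEquiv n
  -- For even n the last direction has no partner, and reduction mod n + 1 pairs it with direction
  -- 0.
  have hp : ∀ j : Fin (n / 2 + 1), ∃ H : (foldedHypercube n).Subgraph,
      Nonempty (H.coe ≃g starK r) ∧ u ∉ H.verts ∧ z ∉ H.verts ∧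
      foldedNeighbor (e ⟨2 * j, by omega⟩) u ∈ H.verts ∧
      foldedNeighbor (e ⟨(2 * j + 1) % (n + 1), Nat.mod_lt _ (by omega)⟩) u ∈ H.verts := by
    intro j
    refine exists_star_through_neighbors hn hr hrn (hz 2 (by omega)) (hz 3 le_rfl) fun h => ?_
    have h1 : 2 * j.1 = (2 * j + 1) % (n + 1) := congrArg Fin.val (e.injective h)
    have h2 : 2 * j.1 ≤ n := by omega
    rcases Nat.eq_or_lt_of_le h2 with h3 | h3
    · rw [h3, Nat.mod_self] at h1
      omega
    · rw [Nat.mod_eq_of_lt (by omega)] at h1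
      omega
  choose H hiso hu hzH hs ht using hp
  refine ⟨Set.range H, ⟨?_, ?_⟩, ?_⟩
  · rintro _ ⟨j, rfl⟩
    exact hiso j
  · intro hconn
    set X : Set (Fin n → Bool) := ⋃ K ∈ Set.range H, K.verts with hX
    have hout : ∀ v, (∀ j, v ∉ (H j).verts) → v ∈ Xᶜ := by
      intro v hv hvX
      simp only [hX, Set.mem_iUnion, Set.mem_range, exists_prop] at hvX
      obtain ⟨_, ⟨j, rfl⟩, hj⟩ := hvX
      exact hv j hj
    have hin : ∀ j, ∀ v ∈ (H j).verts, v ∈ X := by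
      intro j v hv
      simp only [hX, Set.mem_iUnion, Set.mem_range, exists_prop]
      exact ⟨_, ⟨j, rfl⟩, hv⟩
    obtain ⟨p⟩ := hconn ⟨u, hout u hu⟩ ⟨z, hout z hzH⟩
    obtain ⟨w, h, -⟩ := p.exists_eq_cons_of_ne fun h => by
      rw [Subtype.mk.inj h, hammingDist_self] at huz
      omega
    have hw : (foldedHypercube n).Adj u w := h
    obtain ⟨s, hs'⟩ := (foldedHypercube_adj_iff_exists hn2 _ _).1 hw
    refine w.2 ?_
    rw [hs']
    obtain ⟨i, rfl⟩ := e.surjective s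
    rcases Nat.even_or_odd' i.1 with ⟨k, hk | hk⟩
    · have := hs ⟨k, by omega⟩
      have hi : i = ⟨2 * k, by omega⟩ := Fin.ext hk
      rw [hi]
      exact hin _ _ this
    · have := ht ⟨k, by omega⟩
      have hi : i = ⟨(2 * k + 1) % (n + 1), Nat.mod_lt _ (by omega)⟩ := by
        refine Fin.ext (hk.trans (Nat.mod_eq_of_lt ?_).symm)
        omega
      rw [hi]
      exact hin _ _ this
  · rw [← Set.image_univ]
    refine (Set.encard_image_le _ _).trans ?_
    simp

theorem IsStructureCut.isSubstructureCut {V W : Type*} {G : SimpleGraph V} {T : SimpleGraph W}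
    (hT : T.Connected) {F : Set G.Subgraph} (h : IsStructureCut G T F) :
    IsSubstructureCut G T F := by
  refine ⟨fun H hH => ⟨⊤, SimpleGraph.Subgraph.connected_iff'.2 ?_, ?_⟩, h.2⟩
  · exact SimpleGraph.Subgraph.topIso.connected_iff.2 hT
  · exact (h.1 H hH).map fun e => e.trans SimpleGraph.Subgraph.topIso.symm

theorem starK_connected : (starK r).Connected := by
  have h : ∀ v, (starK r).Reachable (Sum.inl 0) v := by
    rintro (v | i)
    · rw [Subsingleton.elim v 0]
    · exact SimpleGraph.Adj.reachable (by simp)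
  exact { preconnected := fun u v => (h u).symm.trans (h v), nonempty := ⟨Sum.inl 0⟩ }

theorem le_encard_of_isSubstructureCut (hn : 7 ≤ n) (hrn : n / 2 * (r + 1) * 2 ≤ n * (n - 1))
    {F : Set (foldedHypercube n).Subgraph}
    (hF : IsSubstructureCut (foldedHypercube n) (starK r) F) :
    ((n / 2 + 1 : ℕ) : ℕ∞) ≤ F.encard := by
  classical
  by_contra! hlt
  have hfin : F.Finite := Set.finite_of_encard_le_coe hlt.le
  rw [hfin.encard_eq_coe_toFinset_card, Nat.cast_lt] at hlt
  -- Passing to vertex sets may identify members of F, which only lowers the count.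
  refine hF.2 (preconnected_induce_compl_of_stars hn hrn
    (hfin.toFinset.image fun H => H.verts.toFinset) ?_ ?_ _ ?_)
  · intro S hS
    obtain ⟨H, hH, rfl⟩ := Finset.mem_image.1 hS
    obtain ⟨T, hT, ⟨e⟩⟩ := hF.1 H (by simpa using hH)
    exact isStarAt_of_iso H T hT e
  · exact Finset.card_image_le.trans (by omega)
  · intro v
    simp

theorem natCeil_half_succ (n : ℕ) : ⌈((n : ℚ) + 1) / 2⌉₊ = n / 2 + 1 := by
  rw [Nat.ceil_eq_iff (by omega)]
  rcases Nat.even_or_odd' n with ⟨k, rfl | rfl⟩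
  · rw [show 2 * k / 2 = k by omega]
    push_cast
    constructor <;> linarith
  · rw [show (2 * k + 1) / 2 = k by omega]
    push_cast
    constructor <;> linarith

theorem seven_le_of_starThreshold_lt (hn : starThreshold r < (n : ℚ)) : 7 ≤ n := by
  have h : (6 : ℚ) < n := by
    refine lt_of_le_of_lt ?_ hn
    unfold starThreshold
    split_ifs <;> exact le_max_left _ _
  exact_mod_cast h

/-- From r = 7 on the quadratic terms of the threshold are at least r + 1; for r ≤ 5 the constant 6
suffices. At r = 6 the threshold is 6, which leaves one exception. -/
theorem star_size_of_starThreshold_lt (hn : starThreshold r < (n : ℚ)) :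
    r + 2 ≤ n ∨ r = 6 ∧ n = 7 := by
  have h7 := seven_le_of_starThreshold_lt hn
  by_cases h5 : r ≤ 5
  · left; omega
  by_cases h6 : r = 6
  · omega
  left
  unfold starThreshold at hn
  split_ifs at hn with hr
  · simp only [max_lt_iff] at hn
    have h1 : ((r ^ 2 + 4 * r : ℕ) : ℚ) < ((8 * n + 5 : ℕ) : ℚ) := by push_cast; linarith [hn.2.2]
    rw [Nat.cast_lt] at h1
    have h7 : 7 ≤ r := by omega
    by_contra! h2
    nlinarith
  · simp only [max_lt_iff] at hn
    have h1 : ((r ^ 2 + 2 * r : ℕ) : ℚ) < ((8 * n + 8 : ℕ) : ℚ) := by push_cast; linarith [hn.2.1]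
    have h2 : ((r ^ 2 + 6 * r : ℕ) : ℚ) < ((12 * n : ℕ) : ℚ) := by push_cast; linarith [hn.2.2.2]
    rw [Nat.cast_lt] at h1 h2
    have h8 : r ≠ 7 := by rintro rfl; exact hr (by decide)
    have h9 : 8 ≤ r := by omega
    by_contra! h3
    nlinarith

theorem half_mul_star_size_le (hn : starThreshold r < (n : ℚ)) :
    n / 2 * (r + 1) * 2 ≤ n * (n - 1) := by
  rcases star_size_of_starThreshold_lt hn with h | ⟨rfl, rfl⟩
  · calc n / 2 * (r + 1) * 2 = n / 2 * 2 * (r + 1) := by ring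
      _ ≤ n * (n - 1) := Nat.mul_le_mul (by omega) (by omega)
  -- Both sides equal 42.
  · norm_num

end StarCut

theorem theorem5p12 (r n : ℕ) (hr : 2 ≤ r) (hn : starThreshold r < (n : ℚ)) :
    structureConnectivity (foldedHypercube n) (starK r) = ((⌈((n : ℚ) + 1) / 2⌉₊ : ℕ) : ℕ∞) ∧
      substructureConnectivity (foldedHypercube n) (starK r) =
        ((⌈((n : ℚ) + 1) / 2⌉₊ : ℕ) : ℕ∞) := by
  have h7 := seven_le_of_starThreshold_lt hn
  have hsize := half_mul_star_size_le hn
  have hrn : r ≤ n + 1 := by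
    rcases star_size_of_starThreshold_lt hn with h | h <;> omega
  rw [natCeil_half_succ]
  obtain ⟨F, hF, hcard⟩ := exists_structureCut h7 hr hrn
  have hF' := hF.isSubstructureCut starK_connected
  refine ⟨le_antisymm ((sInf_le (Set.mem_ofPred.2 ⟨F, hF, rfl⟩)).trans hcard) (le_sInf ?_),
    le_antisymm ((sInf_le (Set.mem_ofPred.2 ⟨F, hF', rfl⟩)).trans hcard)
      (le_sInf ?_)⟩
  · rintro _ ⟨F, hF, rfl⟩
    exact le_encard_of_isSubstructureCut h7 hsize (hF.isSubstructureCut starK_connected)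
  · rintro _ ⟨F, hF, rfl⟩
    exact le_encard_of_isSubstructureCut h7 hsize hF
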